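/- (Ado's theorem.) Let $\mathfrak g$ be a finite-dimensional Lie algebra over $\mathbb C$. Then there exist a finite-dimensional complex vector space $V$ and a representation of $\mathfrak g$ on $V$, that is, a homomorphism of complex Lie algebras $\rho:\mathfrak g\to\mathfrak{gl}(V)$, which is faithful: $\rho$ is injective. -/

import Mathlib

-- The kernel of the adjoint representation is the center, so it is enough to find a
-- finite-dimensional representation faithful on the center and add it to the adjoint one. It is
-- built along a chain `N ≤ r ≤ g`, with `r` the radical and `N = ⁅g, r⁆ + center`. The ideal `N` is
-- nilpotent because `⁅g, r⁆` acts nilpotently on every finite-dimensional module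
-- (`isNilpotent_toEnd_of_mem_lie_radical`: Lie's theorem and a trace argument).
--
-- Each enlargement is a Zassenhaus extension (`HasNilRep.exists_extension`). If `g` is the
-- semidirect product of an ideal `h` and a subalgebra, then `g` acts on `U(h)`: `h` by left
-- multiplication, the subalgebra by derivations. Let `V` be a representation of `h`, nilpotent on
-- `N`, with `⁅g, h⁆ ≤ N`. The elements of `U(h)` lowering the `N`-central series of `V` form a
-- two-sided ideal of finite codimension that contains the image of these derivations. Its powers
-- are therefore stable, and still of finite codimension because `U(h)` is finitely generated. A
-- high power `J` kills `V`, so `U(h) ⧸ J` is a finite-dimensional representation of `g`, nilpotent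
-- on `N`, and an element of `h` acting by zero on it acts by zero on `V`.
--
-- Inside `N`, and from `N` to `r`, the extension adds one dimension at a time. From `r` to `g` the
-- complement is a Levi subalgebra, obtained from Cartan's criterion, a Casimir operator and the
-- codimension-one case of Weyl's theorem.

attribute [local instance 100] LieRing.ofAssociativeRing

/-! ### Products of subspaces of finite codimension. -/

section Cofinite

variable {k A : Type*} [Field k] [Ring A] [Algebra k A]

/-- In a finitely generated algebra, a product of subspaces of finite codimension has finite
codimension. -/
theorem Submodule.exists_fg_sup_mul_eq_top {H K K' F F' : Submodule k A}
    (hH : H.FG) (hadj : Algebra.adjoin k (H : Set A) = ⊤) (hF : F.FG) (hF' : F'.FG)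
    (hK : F ⊔ K = ⊤) (hK' : F' ⊔ K' = ⊤) :
    ∃ F'' : Submodule k A, F''.FG ∧ F'' ⊔ K' * K = ⊤ := by
  wlog h1 : (1 : Submodule k A) ≤ F generalizing F
  · refine this (F := F ⊔ 1) (hF.sup ?_) ?_ le_sup_right
    · rw [Submodule.one_eq_span]; exact Submodule.fg_span_singleton 1
    · rw [eq_top_iff, ← hK]; exact sup_le_sup_right le_sup_left _
  have hE : (F ⊔ H * F).FG := hF.sup (hH.mul hF)
  have : FiniteDimensional k ↥(F ⊔ H * F) := Module.Finite.iff_fg.mpr hE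
  -- `G` collects the relations that rewrite `H * F` modulo `F`; then `F + A * G` is a left ideal
  -- containing `1`, hence all of `A`.
  set G : Submodule k A := (F ⊔ H * F) ⊓ K with hG
  have hGfg : G.FG := by
    have : FiniteDimensional k G := Submodule.finiteDimensional_inf_left _ _
    exact Module.Finite.iff_fg.mp this
  have hHF : H * F ≤ F ⊔ G := by
    intro x hx
    obtain ⟨f, hf, y, hy, rfl⟩ := Submodule.mem_sup.mp (hK ▸ Submodule.mem_top : x ∈ F ⊔ K)
    refine Submodule.add_mem_sup hf ⟨?_, hy⟩
    have := Submodule.sub_mem _ (Submodule.mem_sup_right hx : f + y ∈ F ⊔ H * F)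
      (Submodule.mem_sup_left hf)
    simpa using this
  have hGT : G ≤ ⊤ * G := fun x hx ↦ by
    simpa using Submodule.mul_mem_mul (Submodule.mem_top (x := (1 : A))) hx
  set T : Submodule k A := F ⊔ ⊤ * G with hT
  have hHT : H * T ≤ T := by
    rw [hT, Submodule.mul_sup, ← mul_assoc]
    refine sup_le (hHF.trans (sup_le_sup_left hGT _)) (le_sup_of_le_right ?_)
    exact mul_le_mul' le_top le_rfl
  have hmul (a : A) : ∀ t ∈ T, a * t ∈ T := by
    have ha : a ∈ Algebra.adjoin k (H : Set A) := hadj ▸ Algebra.mem_top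
    induction ha using Algebra.adjoin_induction with
    | mem x hx => exact fun t ht ↦ hHT (Submodule.mul_mem_mul hx ht)
    | algebraMap r => exact fun t ht ↦ by rw [← Algebra.smul_def]; exact T.smul_mem r ht
    | add x y _ _ hx hy => exact fun t ht ↦ by rw [add_mul]; exact T.add_mem (hx t ht) (hy t ht)
    | mul x y _ _ hx hy => exact fun t ht ↦ by rw [mul_assoc]; exact hx _ (hy t ht)
  have hTtop : T = ⊤ := by
    refine eq_top_iff.mpr fun a _ ↦ ?_
    simpa using hmul a 1 (Submodule.mem_sup_left (Submodule.one_le.mp h1))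
  -- From `A = F + A * G` and `A = F' + K'`: `A = F + F' * G + K' * G`, and `G ≤ K`.
  refine ⟨F ⊔ F' * G, hF.sup (hF'.mul hGfg), ?_⟩
  rw [eq_top_iff, ← hTtop, hT, ← hK', Submodule.sup_mul, ← sup_assoc]
  exact sup_le_sup_left (mul_le_mul' le_rfl inf_le_right) _

theorem Submodule.exists_fg_sup_pow_eq_top {H K F : Submodule k A}
    (hH : H.FG) (hadj : Algebra.adjoin k (H : Set A) = ⊤) (hF : F.FG)
    (hK : F ⊔ K = ⊤) (n : ℕ) : ∃ F' : Submodule k A, F'.FG ∧ F' ⊔ K ^ (n + 1) = ⊤ := by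
  induction n with
  | zero => exact ⟨F, hF, by simpa using hK⟩
  | succ n ih =>
    obtain ⟨F', hF', h⟩ := ih
    rw [pow_succ]
    exact exists_fg_sup_mul_eq_top hH hadj hF hF' hK h

end Cofinite

/-! ### Derivations of the enveloping algebra. -/

namespace UniversalEnvelopingAlgebra

variable {k L : Type*} [Field k] [LieRing L] [LieAlgebra k L]

local notation "U" => UniversalEnvelopingAlgebra k L

theorem adjoin_range_ι : Algebra.adjoin k (Set.range (ι k : L →ₗ⁅k⁆ U)) = ⊤ := by
  set S := Algebra.adjoin k (Set.range (ι k : L →ₗ⁅k⁆ U)) with hS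
  let f : L →ₗ⁅k⁆ S :=
    { toFun := fun x ↦ ⟨ι k x, Algebra.subset_adjoin ⟨x, rfl⟩⟩
      map_add' := fun x y ↦ Subtype.ext (by simp)
      map_smul' := fun r x ↦ Subtype.ext (by simp)
      map_lie' := fun {x y} ↦ Subtype.ext (by
        simp [LieRing.of_associative_ring_bracket]) }
  have h : S.val.comp (lift k f) = AlgHom.id k U := by
    apply hom_ext
    ext x
    simp [f]
  refine eq_top_iff.mpr fun u _ ↦ ?_
  have := DFunLike.congr_fun h u
  simp only [AlgHom.comp_apply, AlgHom.id_apply] at this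
  rw [← this]
  exact (lift k f u).2

@[elab_as_elim]
theorem induction_ι {p : U → Prop} (hι : ∀ x : L, p (ι k x)) (halg : ∀ r, p (algebraMap k U r))
    (hadd : ∀ u v, p u → p v → p (u + v)) (hmul : ∀ u v, p u → p v → p (u * v)) (u : U) : p u := by
  have hu : u ∈ Algebra.adjoin k (Set.range (ι k : L →ₗ⁅k⁆ U)) := by
    rw [adjoin_range_ι]; exact Algebra.mem_top
  induction hu using Algebra.adjoin_induction with
  | mem x hx => obtain ⟨y, rfl⟩ := hx; exact hι y
  | algebraMap r => exact halg r
  | add x y _ _ hx hy => exact hadd x y hx hy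
  | mul x y _ _ hx hy => exact hmul x y hx hy

/-- The homomorphism `u ↦ u + ε D u` to the dual numbers. -/
noncomputable def dualNumberHom (D : LieDerivation k L L) : U →ₐ[k] DualNumber U :=
  lift k
    { toFun := fun x ↦ TrivSqZeroExt.inl (ι k x) + TrivSqZeroExt.inr (ι k (D x))
      map_add' := fun x y ↦ by ext <;> simp
      map_smul' := fun r x ↦ by ext <;> simp
      map_lie' := fun {x y} ↦ by
        ext
        · simp [LieRing.of_associative_ring_bracket]
        · simp only [LieDerivation.apply_lie_eq_sub, map_sub, LieHom.map_lie,
            LieRing.of_associative_ring_bracket]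
          simp [-ι_apply]
          abel }

theorem fst_dualNumberHom (D : LieDerivation k L L) (u : U) :
    (dualNumberHom D u).fst = u := by
  have h : (TrivSqZeroExt.fstHom k U U).comp (dualNumberHom D) = AlgHom.id k U := by
    apply hom_ext
    ext x
    simp [dualNumberHom]
  exact DFunLike.congr_fun h u

/-- The extension of a derivation of a Lie algebra to its enveloping algebra. -/
noncomputable def derivation (D : LieDerivation k L L) : U →ₗ[k] U :=
  ((TrivSqZeroExt.sndHom U U).restrictScalars k).comp (dualNumberHom D).toLinearMap

theorem derivation_apply (D : LieDerivation k L L) (u : U) :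
    derivation D u = (dualNumberHom D u).snd := rfl

@[simp]
theorem derivation_ι (D : LieDerivation k L L) (x : L) :
    derivation D (ι k x) = ι k (D x) := by
  rw [derivation_apply, dualNumberHom, lift_ι_apply]
  simp [-ι_apply]

@[simp]
theorem derivation_mul (D : LieDerivation k L L) (u v : U) :
    derivation D (u * v) = derivation D u * v + u * derivation D v := by
  simp [derivation_apply, fst_dualNumberHom, add_comm]

@[simp]
theorem derivation_algebraMap (D : LieDerivation k L L) (r : k) :
    derivation D (algebraMap k U r) = 0 := by
  rw [derivation_apply, AlgHom.commutes]
  exact TrivSqZeroExt.snd_inl U _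

@[simp]
theorem derivation_one (D : LieDerivation k L L) : derivation D (1 : U) = 0 := by
  simpa using derivation_algebraMap D (1 : k)

/-- Only local nilpotency survives the passage to the enveloping algebra: by the Leibniz rule
exponents add under products, so they are unbounded. -/
theorem exists_pow_derivation_eq_zero (D : LieDerivation k L L)
    (hD : IsNilpotent (D : L →ₗ[k] L)) (u : U) : ∃ m, (derivation D ^ m) u = 0 := by
  induction u using induction_ι with
  | hι x =>
    obtain ⟨m, hm⟩ := hD
    refine ⟨m, ?_⟩
    have h (j : ℕ) : (derivation D ^ j) (ι k x) = ι k (((D : L →ₗ[k] L) ^ j) x) := by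
      induction j with
      | zero => simp
      | succ j ih => simp [pow_succ', ih, -ι_apply]
    simp [h, hm, -ι_apply]
  | halg r => exact ⟨1, by simp⟩
  | hadd u v hu hv =>
    obtain ⟨m, hm⟩ := hu
    obtain ⟨n, hn⟩ := hv
    exact ⟨m + n, by
      rw [map_add, Module.End.pow_map_zero_of_le (Nat.le_add_right m n) hm,
        Module.End.pow_map_zero_of_le (Nat.le_add_left n m) hn, add_zero]⟩
  | hmul u v hu hv =>
    obtain ⟨m, hm⟩ := hu
    obtain ⟨n, hn⟩ := hv
    refine ⟨m + n, ?_⟩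
    induction hs : m + n generalizing m n u v with
    | zero =>
      obtain ⟨rfl, rfl⟩ : m = 0 ∧ n = 0 := by omega
      simp_all
    | succ s ih =>
      rcases m with _ | m
      · simp_all
      rcases n with _ | n
      · simp_all
      rw [pow_succ, Module.End.mul_apply, derivation_mul, map_add,
        ih (derivation D u) v m (by simpa [pow_succ] using hm) (n + 1) hn (by omega),
        ih u (derivation D v) (m + 1) hm n (by simpa [pow_succ] using hn) (by omega), add_zero]

end UniversalEnvelopingAlgebra

/-! ### The ideal lowering a relative central series, and its powers. -/

namespace UniversalEnvelopingAlgebra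

section NilpotencyIdeal

variable {k L V : Type*} [Field k] [LieRing L] [LieAlgebra k L] [AddCommGroup V] [Module k V]
  [LieRingModule L V] [LieModule k L V]

theorem lift_toEnd_mem (M : LieSubmodule k L V) (u : UniversalEnvelopingAlgebra k L) :
    ∀ v ∈ M, lift k (LieModule.toEnd k L V) u v ∈ M := by
  induction u using induction_ι with
  | hι x => intro v hv; rw [lift_ι_apply]; exact M.lie_mem hv
  | halg r => intro v hv; rw [AlgHom.commutes]; exact M.smul_mem r hv
  | hadd u w hu hw =>
    intro v hv; rw [map_add]; exact M.add_mem (hu v hv) (hw v hv)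
  | hmul u w hu hw => intro v hv; rw [map_mul]; exact hu _ (hw v hv)

variable (V) in
/-- The elements of the enveloping algebra moving each step of the lower central series of `V`
relative to `N` to the next step. -/
noncomputable def loweringIdeal (N : LieIdeal k L) :
    Submodule k (UniversalEnvelopingAlgebra k L) where
  carrier := {u | ∀ i, ∀ v ∈ N.lcs V i, lift k (LieModule.toEnd k L V) u v ∈ N.lcs V (i + 1)}
  zero_mem' := fun i v _ ↦ by simp
  add_mem' := fun {a b} ha hb i v hv ↦ by
    rw [map_add]; exact add_mem (ha i v hv) (hb i v hv)
  smul_mem' := fun r a ha i v hv ↦ by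
    rw [map_smul]; exact (N.lcs V (i + 1)).smul_mem r (ha i v hv)

variable {N : LieIdeal k L}

theorem mul_mem_loweringIdeal_left (a : UniversalEnvelopingAlgebra k L)
    {u : UniversalEnvelopingAlgebra k L} (hu : u ∈ loweringIdeal V N) :
    a * u ∈ loweringIdeal V N := fun i v hv ↦ by
  rw [map_mul]; exact lift_toEnd_mem _ a _ (hu i v hv)

theorem mul_mem_loweringIdeal_right (a : UniversalEnvelopingAlgebra k L)
    {u : UniversalEnvelopingAlgebra k L} (hu : u ∈ loweringIdeal V N) :
    u * a ∈ loweringIdeal V N := fun i v hv ↦ by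
  rw [map_mul]; exact hu i _ (lift_toEnd_mem _ a _ hv)

theorem ι_mem_loweringIdeal {x : L} (hx : x ∈ N) : ι k x ∈ loweringIdeal V N := fun i v hv ↦ by
  rw [lift_ι_apply, LieIdeal.lcs_succ]
  exact LieSubmodule.lie_mem_lie hx hv

/-- The exponent is `n + 1` because the zeroth power is the line of scalars, which is not an ideal
in general. -/
theorem mul_mem_loweringIdeal_pow_left (n : ℕ) (a : UniversalEnvelopingAlgebra k L) :
    ∀ u ∈ loweringIdeal V N ^ (n + 1), a * u ∈ loweringIdeal V N ^ (n + 1) := by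
  intro u hu
  rw [pow_succ'] at hu ⊢
  induction hu using Submodule.mul_induction_on' with
  | mem_mul_mem x hx y hy =>
    rw [← mul_assoc]; exact Submodule.mul_mem_mul (mul_mem_loweringIdeal_left a hx) hy
  | add x _ y _ hx hy => rw [mul_add]; exact add_mem hx hy

theorem mul_mem_loweringIdeal_pow_right (n : ℕ) (a : UniversalEnvelopingAlgebra k L) :
    ∀ u ∈ loweringIdeal V N ^ (n + 1), u * a ∈ loweringIdeal V N ^ (n + 1) := by
  intro u hu
  rw [pow_succ] at hu ⊢
  induction hu using Submodule.mul_induction_on' with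
  | mem_mul_mem x hx y hy =>
    rw [mul_assoc]; exact Submodule.mul_mem_mul hx (mul_mem_loweringIdeal_right a hy)
  | add x _ y _ hx hy => rw [add_mul]; exact add_mem hx hy

theorem lift_toEnd_mem_lcs_of_mem_loweringIdeal_pow (n : ℕ) :
    ∀ u ∈ loweringIdeal V N ^ n, ∀ i, ∀ v ∈ N.lcs V i,
      lift k (LieModule.toEnd k L V) u v ∈ N.lcs V (i + n) := by
  induction n with
  | zero =>
    intro u _ i v hv
    exact lift_toEnd_mem _ u v hv
  | succ n ih =>
    intro u hu i v hv
    rw [pow_succ] at hu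
    induction hu using Submodule.mul_induction_on' with
    | mem_mul_mem x hx y hy =>
      rw [map_mul, show i + (n + 1) = i + 1 + n by omega]
      exact ih x hx _ _ (hy i v hv)
    | add x _ y _ hx hy => rw [map_add]; exact add_mem hx hy

theorem derivation_mem_loweringIdeal {D : LieDerivation k L L} (hD : ∀ x, D x ∈ N)
    (u : UniversalEnvelopingAlgebra k L) : derivation D u ∈ loweringIdeal V N := by
  induction u using induction_ι with
  | hι x => rw [derivation_ι]; exact ι_mem_loweringIdeal (hD x)
  | halg r => rw [derivation_algebraMap]; exact zero_mem _
  | hadd u w hu hw => rw [map_add]; exact add_mem hu hw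
  | hmul u w hu hw =>
    rw [derivation_mul]
    exact add_mem (mul_mem_loweringIdeal_right _ hu) (mul_mem_loweringIdeal_left _ hw)

theorem derivation_mem_loweringIdeal_pow {D : LieDerivation k L L} (hD : ∀ x, D x ∈ N) (n : ℕ) :
    ∀ u ∈ loweringIdeal V N ^ n, derivation D u ∈ loweringIdeal V N ^ n := by
  induction n with
  | zero =>
    intro u hu
    rw [pow_zero] at hu
    obtain ⟨r, rfl⟩ := Submodule.mem_one.mp hu
    rw [derivation_algebraMap]; exact zero_mem _
  | succ n ih =>
    intro u hu
    rw [pow_succ] at hu ⊢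
    induction hu using Submodule.mul_induction_on' with
    | mem_mul_mem x hx y hy =>
      rw [derivation_mul]
      exact add_mem (Submodule.mul_mem_mul (ih x hx) hy)
        (Submodule.mul_mem_mul hx (derivation_mem_loweringIdeal hD y))
    | add x _ y _ hx hy => rw [map_add]; exact add_mem hx hy

theorem ker_lift_le_loweringIdeal :
    LinearMap.ker (lift k (LieModule.toEnd k L V)).toLinearMap ≤ loweringIdeal V N := by
  intro u hu i v _
  have : lift k (LieModule.toEnd k L V) u = 0 := hu
  simp [this]

/-- The lowering ideal contains the kernel of `U → End V`, whose image is finite-dimensional; powers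
are handled by finite generation of `U`. -/
theorem finite_quotient_loweringIdeal_pow [FiniteDimensional k L] [FiniteDimensional k V] (n : ℕ) :
    FiniteDimensional k (UniversalEnvelopingAlgebra k L ⧸ loweringIdeal V N ^ (n + 1)) := by
  obtain ⟨F, hF⟩ := (LinearMap.ker (lift k (LieModule.toEnd k L V)).toLinearMap).exists_isCompl
  have hFfg : F.FG := by
    have : FiniteDimensional k
        (UniversalEnvelopingAlgebra k L ⧸
          LinearMap.ker (lift k (LieModule.toEnd k L V)).toLinearMap) :=
      Module.Finite.equiv (LinearMap.quotKerEquivRange _).symm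
    exact Module.Finite.iff_fg.mp (Module.Finite.equiv (Submodule.quotientEquivOfIsCompl _ F hF))
  obtain ⟨F', hF', h⟩ := Submodule.exists_fg_sup_pow_eq_top
    (H := LinearMap.range (ι k : L →ₗ⁅k⁆ UniversalEnvelopingAlgebra k L).toLinearMap)
    (K := loweringIdeal V N) (Module.Finite.iff_fg.mp inferInstance) adjoin_range_ι hFfg
    (eq_top_iff.mpr ((codisjoint_iff.mp hF.codisjoint.symm).ge.trans
      (sup_le_sup_left ker_lift_le_loweringIdeal _))) n
  have : FiniteDimensional k F' := Module.Finite.iff_fg.mpr hF'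
  refine Module.Finite.of_surjective ((Submodule.mkQ (loweringIdeal V N ^ (n + 1))).comp F'.subtype)
    fun q ↦ ?_
  obtain ⟨u, rfl⟩ := Submodule.mkQ_surjective _ q
  obtain ⟨f, hf, y, hy, rfl⟩ := Submodule.mem_sup.mp (h ▸ Submodule.mem_top : u ∈ _ ⊔ _)
  refine ⟨⟨f, hf⟩, ?_⟩
  rw [map_add, show Submodule.mkQ (loweringIdeal V N ^ (n + 1)) y = 0 from
    (Submodule.Quotient.mk_eq_zero _).mpr hy]
  simp

/-- This is Engel's theorem for `N` acting on `V`. -/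
theorem lcs_eq_bot_of_isNilpotent [FiniteDimensional k V]
    (hN : ∀ x ∈ N, IsNilpotent (LieModule.toEnd k L V x)) : ∃ n, N.lcs V n = ⊥ := by
  have h : LieModule.IsNilpotent N V :=
    (LieModule.isNilpotent_iff_forall' (R := k)).mpr fun x ↦ hN x x.2
  obtain ⟨n, hn⟩ := (LieModule.isNilpotent_iff k N V).mp h
  refine ⟨n, ?_⟩
  rw [← LieSubmodule.toSubmodule_eq_bot, LieIdeal.coe_lcs_eq, hn]
  rfl

/-- Everything needed to pass the action on the enveloping algebra to a finite-dimensional quotient: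
`J` is a power of the lowering ideal beyond the length of the series, so it acts by zero on `V`. -/
theorem exists_stable_submodule [FiniteDimensional k L] [FiniteDimensional k V]
    (hN : ∀ x ∈ N, IsNilpotent (LieModule.toEnd k L V x)) :
    ∃ J : Submodule k (UniversalEnvelopingAlgebra k L),
      FiniteDimensional k (UniversalEnvelopingAlgebra k L ⧸ J) ∧
      (∀ a, ∀ u ∈ J, a * u ∈ J) ∧
      (∀ x, ι k x ∈ J → LieModule.toEnd k L V x = 0) ∧
      (∀ D : LieDerivation k L L, (∀ x, D x ∈ N) → ∀ u ∈ J, derivation D u ∈ J) ∧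
      ∃ m, ∀ x ∈ N, ∀ u, ι k x ^ m * u ∈ J := by
  obtain ⟨n, hn⟩ := lcs_eq_bot_of_isNilpotent hN
  refine ⟨loweringIdeal V N ^ (n + 1), finite_quotient_loweringIdeal_pow n,
    mul_mem_loweringIdeal_pow_left n, fun x hx ↦ ?_,
    fun D hD ↦ derivation_mem_loweringIdeal_pow hD _,
    n + 1, fun x hx u ↦ mul_mem_loweringIdeal_pow_right n u _
      (Submodule.pow_mem_pow _ (ι_mem_loweringIdeal hx) _)⟩
  ext v
  have h := lift_toEnd_mem_lcs_of_mem_loweringIdeal_pow (n + 1) _ hx 0 v (by simp)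
  rw [lift_ι_apply, zero_add, LieIdeal.lcs_succ, hn, LieSubmodule.lie_bot,
    LieSubmodule.mem_bot] at h
  simpa using h

end NilpotencyIdeal

/-! ### The action of a split extension on the enveloping algebra of its kernel. -/

section SplitAction

variable {k g s : Type*} [Field k] [LieRing g] [LieAlgebra k g] [LieRing s] [LieAlgebra k s]

/-- Such a `T` commutes with all right multiplications, so it is determined by its value at `1`. It
is applied to the defects of additivity, homogeneity and bracket compatibility in `splitAction`. -/
theorem end_eq_zero_of_mul_ι {L : Type*} [LieRing L] [LieAlgebra k L]
    {T : Module.End k (UniversalEnvelopingAlgebra k L)} (h1 : T 1 = 0)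
    (hT : ∀ u x, T (u * ι k x) = T u * ι k x) : T = 0 := by
  have key (v : UniversalEnvelopingAlgebra k L) : ∀ u, T (u * v) = T u * v := by
    induction v using induction_ι with
    | hι x => exact fun u ↦ hT u x
    | halg r => intro u; simp [← Algebra.commutes, ← Algebra.smul_def]
    | hadd v w hv hw => intro u; rw [mul_add, map_add, hv, hw, mul_add]
    | hmul v w hv hw => intro u; rw [← mul_assoc, hw, hv, mul_assoc]
  ext u
  simpa [h1] using key u 1

/-- The restriction of an inner derivation to an ideal. -/
def adIdeal (I : LieIdeal k g) (y : g) : LieDerivation k I I where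
  toLinearMap := LieModule.toEnd k g I y
  leibniz' := fun a b ↦ by
    ext
    simp only [LieModule.toEnd_apply_apply, LieSubmodule.coe_bracket, LieSubmodule.coe_sub,
      LieIdeal.coe_bracket_of_module, LieSubmodule.coe_bracket]
    rw [leibniz_lie y (a : g) (b : g), ← lie_skew (b : g)]
    abel

@[simp]
theorem coe_adIdeal_apply (I : LieIdeal k g) (y : g) (x : I) :
    (adIdeal I y x : g) = ⁅y, (x : g)⁆ := rfl

variable (π : g →ₗ⁅k⁆ s) (σ : s →ₗ⁅k⁆ g) (hσ : ∀ t, π (σ t) = t)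

/-- The projection to the kernel of a split surjection. -/
def kerPart (y : g) : π.ker := ⟨y - σ (π y), by simp [LieHom.mem_ker, hσ]⟩

/-- The underlying map of `splitAction`. -/
noncomputable def splitActionAux (y : g) : Module.End k (UniversalEnvelopingAlgebra k π.ker) :=
  LinearMap.mulLeft k (ι k (kerPart π σ hσ y)) + derivation (adIdeal π.ker (σ (π y)))

theorem splitActionAux_one (y : g) :
    splitActionAux π σ hσ y 1 = ι k (kerPart π σ hσ y) := by
  simp [splitActionAux, -ι_apply]

theorem splitActionAux_mul_ι (y : g) (u : UniversalEnvelopingAlgebra k π.ker) (x : π.ker) :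
    splitActionAux π σ hσ y (u * ι k x) =
      splitActionAux π σ hσ y u * ι k x + u * ι k (adIdeal π.ker (σ (π y)) x) := by
  simp [splitActionAux, -ι_apply, mul_assoc, add_mul, add_assoc]

/-- For a Lie algebra `g` split over an ideal, the action of `g` on the enveloping algebra of the
ideal where the ideal acts by left multiplication and its complement acts by derivations. -/
noncomputable def splitAction : g →ₗ⁅k⁆ Module.End k (UniversalEnvelopingAlgebra k π.ker) where
  toFun := splitActionAux π σ hσ
  map_add' y z := by
    rw [← sub_eq_zero]
    refine end_eq_zero_of_mul_ι ?_ fun u x ↦ ?_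
    · simp only [LinearMap.sub_apply, LinearMap.add_apply, splitActionAux_one]
      rw [← map_add, ← map_sub, ← map_zero (ι k)]
      congr 1
      ext
      simp [kerPart]
      abel
    · simp only [LinearMap.sub_apply, LinearMap.add_apply, splitActionAux_mul_ι]
      have : adIdeal π.ker (σ (π (y + z))) x =
          adIdeal π.ker (σ (π y)) x + adIdeal π.ker (σ (π z)) x := by
        ext; simp
      rw [this, map_add]
      noncomm_ring
  map_smul' r y := by
    rw [← sub_eq_zero]
    refine end_eq_zero_of_mul_ι ?_ fun u x ↦ ?_
    · simp only [LinearMap.sub_apply, LinearMap.smul_apply, splitActionAux_one, RingHom.id_apply]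
      rw [← map_smul, ← map_sub, ← map_zero (ι k)]
      congr 1
      ext
      simp [kerPart, smul_sub]
    · simp only [LinearMap.sub_apply, LinearMap.smul_apply, splitActionAux_mul_ι,
        RingHom.id_apply]
      have : adIdeal π.ker (σ (π (r • y))) x = r • adIdeal π.ker (σ (π y)) x := by
        ext; simp
      rw [this, map_smul, sub_mul, smul_add, mul_smul_comm, smul_mul_assoc]
      abel
  map_lie' {y z} := by
    rw [← sub_eq_zero]
    refine end_eq_zero_of_mul_ι ?_ fun u x ↦ ?_
    · simp only [LinearMap.sub_apply, LieRing.of_associative_ring_bracket, Module.End.mul_apply,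
        splitActionAux_one]
      rw [← one_mul (ι k (kerPart π σ hσ z)), ← one_mul (ι k (kerPart π σ hσ y)),
        splitActionAux_mul_ι, splitActionAux_mul_ι, splitActionAux_one, splitActionAux_one,
        one_mul, one_mul]
      have : kerPart π σ hσ ⁅y, z⁆ = ⁅kerPart π σ hσ y, kerPart π σ hσ z⁆ +
          adIdeal π.ker (σ (π y)) (kerPart π σ hσ z) -
          adIdeal π.ker (σ (π z)) (kerPart π σ hσ y) := by
        ext
        simp only [kerPart, LieHom.map_lie, LieSubmodule.coe_sub, LieSubmodule.coe_add,
          LieSubmodule.coe_bracket, coe_adIdeal_apply, LieIdeal.coe_bracket_of_module, lie_sub, sub_lie]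
        rw [← lie_skew y (σ (π z)), ← lie_skew (σ (π y)) (σ (π z))]
        abel
      rw [this, map_sub, map_add, LieHom.map_lie, LieRing.of_associative_ring_bracket]
      abel
    · simp only [LinearMap.sub_apply, LieRing.of_associative_ring_bracket, Module.End.mul_apply,
        splitActionAux_mul_ι, map_add]
      have : adIdeal π.ker (σ (π ⁅y, z⁆)) x =
          adIdeal π.ker (σ (π y)) (adIdeal π.ker (σ (π z)) x) -
          adIdeal π.ker (σ (π z)) (adIdeal π.ker (σ (π y)) x) := by
        ext; simp
      rw [this, map_sub]
      noncomm_ring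

theorem splitAction_apply (y : g) (u : UniversalEnvelopingAlgebra k π.ker) :
    splitAction π σ hσ y u =
      ι k (kerPart π σ hσ y) * u + derivation (adIdeal π.ker (σ (π y))) u := rfl

end SplitAction

end UniversalEnvelopingAlgebra

/-! ### Extending nilpotent representations. -/

namespace LieAlgebra

variable {k g s : Type*} [Field k] [LieRing g] [LieAlgebra k g] [LieRing s] [LieAlgebra k s]

variable (k) in
/-- `g` has a finite-dimensional representation which is nilpotent on `N` and faithful on `S`. -/
def HasNilRep (N S : Set g) : Prop :=
  ∃ (n : ℕ) (ρ : g →ₗ⁅k⁆ Module.End k (Fin n → k)),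
    (∀ x ∈ N, IsNilpotent (ρ x)) ∧ ∀ x ∈ S, ρ x = 0 → x = 0

theorem exists_conj_rep {V : Type*} [AddCommGroup V] [Module k V] [FiniteDimensional k V]
    (ρ : g →ₗ⁅k⁆ Module.End k V) :
    ∃ (n : ℕ) (ρ' : g →ₗ⁅k⁆ Module.End k (Fin n → k)),
      (∀ x, IsNilpotent (ρ x) → IsNilpotent (ρ' x)) ∧ ∀ x, ρ' x = 0 → ρ x = 0 := by
  let e := (Module.finBasis k V).equivFun
  refine ⟨Module.finrank k V, (e.lieConj : Module.End k V →ₗ⁅k⁆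
    Module.End k (Fin (Module.finrank k V) → k)).comp ρ, fun x hx ↦ ?_, fun x hx ↦ ?_⟩
  · exact hx.map e.conjRingEquiv
  · exact e.lieConj.injective (hx.trans (map_zero e.lieConj).symm)

theorem HasNilRep.of_rep {V : Type*} [AddCommGroup V] [Module k V] [FiniteDimensional k V]
    {N S : Set g} (ρ : g →ₗ⁅k⁆ Module.End k V) (hN : ∀ x ∈ N, IsNilpotent (ρ x))
    (hS : ∀ x ∈ S, ρ x = 0 → x = 0) : HasNilRep k N S := by
  obtain ⟨n, ρ', h₁, h₂⟩ := exists_conj_rep ρ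
  exact ⟨n, ρ', fun x hx ↦ h₁ x (hN x hx), fun x hx h ↦ hS x hx (h₂ x h)⟩

theorem HasNilRep.comap {N S : Set g} (h : HasNilRep k N S) {f : s →ₗ⁅k⁆ g}
    (hf : Function.Injective f) {N' S' : Set s} (hN : ∀ x ∈ N', f x ∈ N) (hS : ∀ x ∈ S', f x ∈ S) :
    HasNilRep k N' S' := by
  obtain ⟨n, ρ, h₁, h₂⟩ := h
  exact ⟨n, ρ.comp f, fun x hx ↦ h₁ _ (hN x hx), fun x hx h ↦
    hf ((h₂ _ (hS x hx) h).trans (map_zero f).symm)⟩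

open UniversalEnvelopingAlgebra in
/-- Zassenhaus extension of a representation of an ideal which has a complementary subalgebra. -/
theorem HasNilRep.exists_extension [FiniteDimensional k g] {π : g →ₗ⁅k⁆ s} {σ : s →ₗ⁅k⁆ g}
    (hσ : ∀ t, π (σ t) = t) {N : LieIdeal k g} {S : Set g} (hN : N ≤ π.ker)
    (hS : S ⊆ π.ker) (hgN : ∀ y : g, ∀ x ∈ π.ker, ⁅y, x⁆ ∈ N)
    (h : HasNilRep k {x : π.ker | (x : g) ∈ N} {x : π.ker | (x : g) ∈ S}) :
    ∃ (n : ℕ) (ρ : g →ₗ⁅k⁆ Module.End k (Fin n → k)),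
      (∀ x ∈ N, IsNilpotent (ρ x)) ∧ (∀ x ∈ S, ρ x = 0 → x = 0) ∧
      ∀ t, IsNilpotent (ad k g (σ t)) → IsNilpotent (ρ (σ t)) := by
  obtain ⟨n, ρ, hρN, hρS⟩ := h
  let _ : LieRingModule π.ker (Fin n → k) := LieRingModule.compLieHom (Fin n → k) ρ
  have : LieModule k π.ker (Fin n → k) := LieModule.compLieHom (Fin n → k) ρ
  have hρ (x : π.ker) : LieModule.toEnd k π.ker (Fin n → k) x = ρ x := rfl
  obtain ⟨J, hfin, hmul, hfaith, hder, m, hnil⟩ :=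
    exists_stable_submodule (V := Fin n → k) (N := N.comap π.ker.incl)
      (fun x hx ↦ hρN x (by simpa using hx))
  have hadN (y : g) (x : π.ker) : adIdeal π.ker y x ∈ N.comap π.ker.incl := by
    simpa using hgN y x x.2
  -- The left multiplication part preserves `J` as a left ideal; the derivation part does because it
  -- maps the kernel into `N`.
  have hstab (y : g) : J ≤ J.comap (splitAction π σ hσ y) := fun u hu ↦
    J.add_mem (hmul _ u hu) (hder _ (hadN _) u hu)
  let ρ' : g →ₗ⁅k⁆ Module.End k (UniversalEnvelopingAlgebra k π.ker ⧸ J) :=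
    { toFun := fun y ↦ J.mapQ J (splitAction π σ hσ y) (hstab y)
      map_add' := fun y z ↦ by
        ext u; simp
      map_smul' := fun r y ↦ by
        ext u; simp
      map_lie' := fun {y z} ↦ by
        ext u
        simp [LieRing.of_associative_ring_bracket] }
  have hρ' (y : g) (u) : ρ' y (J.mkQ u) = J.mkQ (splitAction π σ hσ y u) := rfl
  have hpow (y : g) (j : ℕ) (u) : (ρ' y ^ j) (J.mkQ u) = J.mkQ ((splitAction π σ hσ y ^ j) u) := by
    induction j with
    | zero => rfl
    | succ j ih => rw [pow_succ', pow_succ', Module.End.mul_apply, ih, hρ']; rfl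
  have hker (x : π.ker) (u) : splitAction π σ hσ x u = ι k x * u := by
    have h0 : π x = 0 := x.2
    have h1 : kerPart π σ hσ (x : g) = x := by ext; simp [kerPart, h0]
    have h2 : adIdeal π.ker (σ (π x)) = 0 := by ext z; simp [h0]
    have h3 : derivation (0 : LieDerivation k π.ker π.ker) u = 0 := by
      induction u using induction_ι with
      | hι x => simp [-ι_apply]
      | halg r => simp
      | hadd u w hu hw => rw [map_add, hu, hw, add_zero]
      | hmul u w hu hw => rw [derivation_mul, hu, hw]; simp
    rw [splitAction_apply, h1, h2, h3, add_zero]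
  obtain ⟨n', ρ'', h₁, h₂⟩ := exists_conj_rep ρ'
  refine ⟨n', ρ'', fun x hx ↦ h₁ x ⟨m, ?_⟩, fun x hx h ↦ ?_, fun t ht ↦ h₁ _ ?_⟩
  · ext u
    obtain ⟨x, rfl⟩ : ∃ y : π.ker, (y : g) = x := ⟨⟨x, hN hx⟩, rfl⟩
    have (j : ℕ) (u) : (splitAction π σ hσ (x : g) ^ j) u = ι k x ^ j * u := by
      induction j with
      | zero => simp
      | succ j ih => rw [pow_succ', pow_succ', Module.End.mul_apply, ih, hker, mul_assoc]
    change (ρ' x ^ m) (J.mkQ u) = 0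
    rw [hpow, this]
    exact (Submodule.Quotient.mk_eq_zero _).mpr (hnil x (by simpa using hx) u)
  · obtain ⟨x, rfl⟩ : ∃ y : π.ker, (y : g) = x := ⟨⟨x, hS hx⟩, rfl⟩
    -- Evaluating at the class of `1` gives `ι x ∈ J`, so `x` already acts by zero in the original
    -- representation.
    have h' := LinearMap.congr_fun (h₂ _ h) (J.mkQ 1)
    rw [hρ', hker, mul_one] at h'
    exact congrArg Subtype.val
      (hρS x hx (hfaith x ((Submodule.Quotient.mk_eq_zero _).mp h')))
  · rw [Module.End.isNilpotent_iff_of_finite]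
    intro q
    obtain ⟨u, rfl⟩ := J.mkQ_surjective q
    -- The complement acts by pure derivations; these are locally nilpotent, which suffices on the
    -- finite-dimensional quotient.
    have hs : splitAction π σ hσ (σ t) = derivation (adIdeal π.ker (σ t)) := by
      ext u
      have : kerPart π σ hσ (σ t) = 0 := by ext; simp [kerPart, hσ]
      rw [splitAction_apply, this, hσ]
      simp [-ι_apply]
    obtain ⟨j, hj⟩ := exists_pow_derivation_eq_zero (adIdeal π.ker (σ t)) (by
      obtain ⟨j, hj⟩ := ht
      refine ⟨j, ?_⟩
      ext x
      have (i : ℕ) : ((((adIdeal π.ker (σ t) : π.ker →ₗ[k] π.ker) ^ i) x : π.ker) : g) =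
          (ad k g (σ t) ^ i) x := by
        induction i with
        | zero => rfl
        | succ i ih => rw [pow_succ', pow_succ', Module.End.mul_apply, Module.End.mul_apply, ← ih]; rfl
      rw [this, hj]; rfl) u
    exact ⟨j, by rw [hpow, hs, hj, map_zero]⟩

/-- The Lie algebra homomorphism to the one-dimensional abelian Lie algebra given by a linear
functional vanishing on commutators. -/
def homOfFunctional (f : g →ₗ[k] k) (hf : ∀ x y : g, f ⁅x, y⁆ = 0) : g →ₗ⁅k⁆ k :=
  { f with
    map_lie' := fun {x y} ↦ by
      simp [hf, LieRing.of_associative_ring_bracket, mul_comm] }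

theorem exists_split_hom_to_field (f : g →ₗ[k] k) (hf : ∀ x y : g, f ⁅x, y⁆ = 0) (hf0 : f ≠ 0) :
    ∃ (π : g →ₗ⁅k⁆ k) (σ : k →ₗ⁅k⁆ g), (∀ x, π x = f x) ∧ ∀ t, π (σ t) = t := by
  obtain ⟨x, hx⟩ : ∃ x, f x = 1 := by
    obtain ⟨y, hy⟩ := DFunLike.ne_iff.mp hf0
    exact ⟨(f y)⁻¹ • y, by simpa using inv_mul_cancel₀ hy⟩
  refine ⟨homOfFunctional f hf, { LinearMap.toSpanSingleton k g x with
    map_lie' := fun {s t} ↦ ?_ }, fun _ ↦ rfl, fun t ↦ ?_⟩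
  · simp [LieRing.of_associative_ring_bracket, mul_comm]
  · change f (t • x) = t
    simp [hx]

theorem finrank_ker_lt [FiniteDimensional k g] {π : g →ₗ⁅k⁆ k} {σ : k →ₗ⁅k⁆ g}
    (hσ : ∀ t, π (σ t) = t) : Module.finrank k π.ker < Module.finrank k g := by
  refine Submodule.finrank_lt (s := π.ker.toSubmodule) fun h ↦ one_ne_zero (α := k) ?_
  have : σ 1 ∈ π.ker.toSubmodule := h ▸ Submodule.mem_top
  rw [← hσ 1]
  exact this

theorem ker_sup_span_eq_top {π : g →ₗ⁅k⁆ k} {σ : k →ₗ⁅k⁆ g}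
    (hσ : ∀ t, π (σ t) = t) : (k ∙ σ 1) ⊔ π.ker.toSubmodule = ⊤ := by
  refine eq_top_iff.mpr fun x _ ↦ ?_
  have : x = π x • σ 1 + (x - π x • σ 1) := by abel
  rw [this]
  refine Submodule.add_mem_sup (Submodule.smul_mem _ _ (Submodule.mem_span_singleton_self _)) ?_
  change π _ = 0
  simp [hσ]

/-- The projection to the quotient by an ideal. -/
def quotientHom (I : LieIdeal k g) : g →ₗ⁅k⁆ g ⧸ I :=
  { (LieSubmodule.Quotient.mk' I : g →ₗ[k] g ⧸ I) with
    map_lie' := fun {x y} ↦ LieSubmodule.Quotient.mk_bracket I x y }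

theorem quotientHom_surjective (I : LieIdeal k g) : Function.Surjective (quotientHom I) :=
  LieSubmodule.Quotient.surjective_mk' I

theorem quotientHom_eq_zero_iff (I : LieIdeal k g) {x : g} : quotientHom I x = 0 ↔ x ∈ I :=
  LieSubmodule.Quotient.mk_eq_zero I

/-- The restriction of a homomorphism to ideals. -/
def restrictHom (f : s →ₗ⁅k⁆ g) {J : LieIdeal k s} {I : LieIdeal k g} (h : ∀ x ∈ J, f x ∈ I) :
    J →ₗ⁅k⁆ I where
  toFun x := ⟨f x, h x x.2⟩
  map_add' x y := by ext; simp
  map_smul' r x := by ext; simp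
  map_lie' {x y} := by ext; simp

/-- The inductive step of Engel's theorem: a nilpotently acting ideal together with one nilpotent
element spanning a complement. -/
theorem isNilpotent_of_ker {V : Type*} [AddCommGroup V] [Module k V] [FiniteDimensional k V]
    {π : g →ₗ⁅k⁆ k} {σ : k →ₗ⁅k⁆ g} (hσ : ∀ t, π (σ t) = t) {ρ : g →ₗ⁅k⁆ Module.End k V}
    (hker : ∀ x ∈ π.ker, IsNilpotent (ρ x)) (h : IsNilpotent (ρ (σ 1))) (x : g) :
    IsNilpotent (ρ x) := by
  let _ : LieRingModule g V := LieRingModule.compLieHom V ρ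
  have : LieModule k g V := LieModule.compLieHom V ρ
  have hρ (y : g) : LieModule.toEnd k g V y = ρ y := rfl
  have hI : LieModule.IsNilpotent π.ker V := by
    refine (LieModule.isNilpotent_iff_forall' (R := k)).mpr fun x ↦ ?_
    have hx : IsNilpotent (LieModule.toEnd k g V x) := by
      rw [hρ]
      exact hker x x.2
    exact hx
  have : LieModule.IsNilpotent g V :=
    LieSubmodule.isNilpotentOfIsNilpotentSpanSupEqTop (R := k) (I := π.ker) (x := σ 1)
      (ker_sup_span_eq_top hσ)
      (by rwa [hρ]) hI
  exact LieModule.isNilpotent_toEnd_of_isNilpotent k g V x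

/-- A nilpotent Lie algebra has a nilpotent representation faithful on a given abelian ideal. -/
theorem hasNilRep_of_isNilpotent [FiniteDimensional k g] [LieRing.IsNilpotent g] (Z : LieIdeal k g)
    [IsLieAbelian Z] : HasNilRep k (Set.univ : Set g) (Z : Set g) := by
  induction hd : Module.finrank k g using Nat.strong_induction_on generalizing g with
  | h d ih =>
  by_cases hZ : Z = ⊤
  · have hab (x y : g) : ⁅x, y⁆ = 0 := by
      have := congrArg Subtype.val (LieModule.IsTrivial.trivial
        (⟨x, hZ ▸ LieSubmodule.mem_top x⟩ : Z) (⟨y, hZ ▸ LieSubmodule.mem_top y⟩ : Z))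
      simpa using this
    -- For abelian `g`, let `x` act on `g × k` by `(v, c) ↦ (c • x, 0)`: faithful, and all products
    -- vanish.
    let ρ : g →ₗ⁅k⁆ Module.End k (g × k) :=
      { toFun := fun x ↦ (LinearMap.inl k g k).comp ((LinearMap.toSpanSingleton k g x).comp
          (LinearMap.snd k g k))
        map_add' := fun x y ↦ by ext <;> simp
        map_smul' := fun r x ↦ by ext <;> simp
        map_lie' := fun {x y} ↦ by
          rw [hab]; ext <;> simp [LieRing.of_associative_ring_bracket] }
    refine HasNilRep.of_rep ρ (fun x _ ↦ ⟨2, ?_⟩) fun x _ hx ↦ ?_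
    · ext <;> simp [ρ, pow_two]
    · have := LinearMap.congr_fun hx ((0 : g), (1 : k))
      simpa [ρ] using this
  · have : Nontrivial (g ⧸ Z) := Submodule.Quotient.nontrivial_iff.mpr
      (by rwa [Ne, LieSubmodule.toSubmodule_eq_top])
    have : LieRing.IsNilpotent (g ⧸ Z) :=
      (quotientHom_surjective Z).lieAlgebra_isNilpotent
    -- A functional killing `Z` and all commutators gives a codimension-one ideal containing `Z`,
    -- with a one-dimensional complementary subalgebra.
    obtain ⟨f, hf0, hf⟩ := Submodule.exists_le_ker_of_lt_top
      (derivedSeries k (g ⧸ Z) 1).toSubmodule (derivedSeries_lt_top_of_solvable k (g ⧸ Z))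
    have hcomm (x y : g ⧸ Z) : f ⁅x, y⁆ = 0 :=
      hf (LieSubmodule.lie_mem_lie (LieSubmodule.mem_top x) (LieSubmodule.mem_top y))
    obtain ⟨π, σ, hπ, hσ⟩ := exists_split_hom_to_field (f.comp (quotientHom Z).toLinearMap)
      (fun x y ↦ by simp [hcomm]) (fun h ↦ hf0 <| LinearMap.ext fun q ↦ by
        obtain ⟨x, rfl⟩ := quotientHom_surjective Z q
        exact LinearMap.congr_fun h x)
    have hZπ : Z ≤ π.ker := fun x hx ↦ by
      rw [LieHom.mem_ker, hπ]
      simp [(quotientHom_eq_zero_iff Z).mpr hx]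
    have : LieRing.IsNilpotent π.ker :=
      Function.Injective.lieAlgebra_isNilpotent (f := π.ker.incl) Subtype.val_injective
    have : IsLieAbelian (Z.comap π.ker.incl) := ⟨fun x y ↦ by
      ext
      have := congrArg Subtype.val (LieModule.IsTrivial.trivial
        (⟨_, x.2⟩ : Z) (⟨_, y.2⟩ : Z))
      exact this⟩
    have h₀ := ih _ (hd ▸ finrank_ker_lt hσ) (Z.comap π.ker.incl) rfl
    have h₁ : HasNilRep k {x : π.ker | (x : g) ∈ π.ker} {x : π.ker | (x : g) ∈ (Z : Set g)} :=
      h₀.comap (f := LieHom.id) Function.injective_id (fun _ _ ↦ Set.mem_univ _)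
        fun x hx ↦ by simpa using hx
    obtain ⟨n, ρ, hρN, hρS, hρσ⟩ := HasNilRep.exists_extension hσ (N := π.ker) (S := Z) le_rfl hZπ
      (fun y x hx ↦ LieSubmodule.lie_mem _ hx) h₁
    refine ⟨n, ρ, fun x _ ↦ isNilpotent_of_ker hσ hρN
      (hρσ 1 (LieModule.isNilpotent_toEnd_of_isNilpotent k g g (σ 1))) x, hρS⟩

/-- A nilpotent representation of an ideal containing all commutators extends, without shrinking the
set on which it is faithful. -/
theorem HasNilRep.of_commutator_le [FiniteDimensional k g] {N : LieIdeal k g} {S : Set g}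
    (hSN : S ⊆ N) (hN : ∀ x y : g, ⁅x, y⁆ ∈ N)
    (h : HasNilRep k (Set.univ : Set N) {x : N | (x : g) ∈ S}) :
    HasNilRep k (N : Set g) S := by
  induction hd : Module.finrank k g using Nat.strong_induction_on generalizing g with
  | h d ih =>
  by_cases hN' : N = ⊤
  · subst hN'
    exact h.comap (f := (LieSubalgebra.topEquiv (R := k) (L := g)).symm.toLieHom)
      (LieEquiv.injective _) (fun _ _ ↦ Set.mem_univ _) fun x hx ↦ hx
  -- Any hyperplane containing `N` is an ideal, since `N` contains all commutators.
  · obtain ⟨f, hf0, hf⟩ := Submodule.exists_le_ker_of_lt_top N.toSubmodule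
      (lt_top_iff_ne_top.mpr (by rwa [Ne, LieSubmodule.toSubmodule_eq_top]))
    obtain ⟨π, σ, hπ, hσ⟩ := exists_split_hom_to_field f (fun x y ↦ hf (hN x y)) hf0
    have hNπ : N ≤ π.ker := fun x hx ↦ by rw [LieHom.mem_ker, hπ]; exact hf hx
    obtain ⟨n, ρ, hρN, hρS, -⟩ := HasNilRep.exists_extension hσ (N := N) (S := S) hNπ
      (hSN.trans hNπ) (fun y x _ ↦ hN y x)
      (ih _ (hd ▸ finrank_ker_lt hσ) (N := N.comap π.ker.incl)
        (S := {x : π.ker | (x : g) ∈ S}) (fun x hx ↦ hSN hx) (fun x y ↦ hN x y)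
        (h.comap (f := restrictHom π.ker.incl (fun x hx ↦ hx)) (fun x y hxy ↦
          Subtype.ext (Subtype.ext (congrArg (fun z : N ↦ (z : g)) hxy)))
          (fun _ _ ↦ Set.mem_univ _) (fun x hx ↦ hx)) rfl)
    exact ⟨n, ρ, hρN, hρS⟩

end LieAlgebra

/-! ### Cartan's criterion, Casimir operators and Weyl's theorem in codimension one. -/

namespace LieAlgebra

open LieModule

variable {k s E : Type*} [Field k] [LieRing s] [LieAlgebra k s]
  [AddCommGroup E] [Module k E] [LieRingModule s E] [LieModule k s E]

/-- If `x` acts nilpotently on `E`, then `ad` of its image in `End E` is nilpotent; injectivity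
carries this back to `ad x`, and Engel's theorem concludes. -/
theorem isNilpotent_of_injective_toEnd [FiniteDimensional k s] [FiniteDimensional k E]
    (hinj : Function.Injective (toEnd k s E)) [LieModule.IsNilpotent s E] :
    LieRing.IsNilpotent s := by
  rw [LieAlgebra.isNilpotent_iff_forall (R := k)]
  intro x
  obtain ⟨n, hn⟩ := ad_nilpotent_of_nilpotent (R := k) (isNilpotent_toEnd_of_isNilpotent k s E x)
  refine ⟨n, LinearMap.ext fun y ↦ hinj ?_⟩
  have h (j : ℕ) : toEnd k s E ((ad k s x ^ j) y) =
      (ad k (Module.End k E) (toEnd k s E x) ^ j) (toEnd k s E y) := by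
    induction j with
    | zero => rfl
    | succ j ih =>
      rw [pow_succ', pow_succ', Module.End.mul_apply, Module.End.mul_apply, ← ih, ad_apply,
        ad_apply, LieHom.map_lie]
  rw [h, hn]
  simp

/-- **Cartan's criterion** for a Lie algebra of endomorphisms. -/
theorem isSolvable_of_traceForm_eq_zero [CharZero k] [FiniteDimensional k s] [FiniteDimensional k E]
    (hinj : Function.Injective (toEnd k s E)) (h : traceForm k s E = 0) : IsSolvable s := by
  have h₁ : LieModule.IsNilpotent (derivedSeries k s 1) E :=
    isNilpotent_derivedSeries_of_traceForm_eq_zero h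
  have h₂ : LieRing.IsNilpotent (derivedSeries k s 1) :=
    isNilpotent_of_injective_toEnd (k := k) (E := E) fun x y hxy ↦ Subtype.ext (hinj hxy)
  obtain ⟨n, hn⟩ := IsSolvable.solvable k (derivedSeries k s 1)
  rw [LieIdeal.derivedSeries_eq_bot_iff] at hn
  refine IsSolvable.mk (R := k) (k := n + 1) ?_
  rwa [derivedSeries_def, derivedSeriesOfIdeal_add]

variable (k s E) in
/-- An ideal complementary to the kernel of a representation, on which the trace form is
nondegenerate. -/
theorem exists_ideal_traceForm_nondegenerate [CharZero k] [FiniteDimensional k s]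
    [FiniteDimensional k E] [HasTrivialRadical k s] :
    ∃ J : LieIdeal k s, (traceForm k J E).Nondegenerate ∧ (J = ⊥ → toEnd k s E = 0) := by
  set I : LieIdeal k s := (toEnd k s E).ker with hI
  set J : LieIdeal k s := I.killingCompl with hJ
  have hIJ : IsCompl I J := I.isCompl_killingCompl
  refine ⟨J, ?_, fun hJ0 ↦ ?_⟩
  · refine (traceForm_isSymm k J E).isRefl.nondegenerate_iff_separatingLeft.mpr ?_
    -- The part of `J` orthogonal to `s` is an ideal acting faithfully with zero trace form, so
    -- Cartan's criterion makes it solvable, hence zero.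
    let K : LieIdeal k s :=
      { carrier := {x | x ∈ J ∧ ∀ y, traceForm k s E x y = 0}
        zero_mem' := ⟨J.zero_mem, fun y ↦ by simp⟩
        add_mem' := fun ha hb ↦ ⟨add_mem ha.1 hb.1, fun y ↦ by simp [ha.2, hb.2]⟩
        smul_mem' := fun r a ha ↦ ⟨J.smul_mem r ha.1, fun y ↦ by simp [ha.2]⟩
        lie_mem := fun {x a} ha ↦ ⟨J.lie_mem ha.1, fun y ↦ by
          rw [traceForm_apply_lie_apply', ha.2, neg_zero]⟩ }
    have hinj : Function.Injective (toEnd k K E) := by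
      rw [injective_iff_map_eq_zero]
      intro x hx
      have hxI : (x : s) ∈ I := hx
      have : (x : s) ∈ I ⊓ J := ⟨hxI, x.2.1⟩
      rw [hIJ.inf_eq_bot] at this
      exact Subtype.ext this
    have hsol : IsSolvable K := isSolvable_of_traceForm_eq_zero (k := k) (E := E) hinj (by
      ext x y
      exact x.2.2 y)
    have hK : K = ⊥ := HasTrivialRadical.eq_bot_of_isSolvable K
    intro x hx
    have hxK : (x : s) ∈ K := by
      refine ⟨x.2, fun y ↦ ?_⟩
      obtain ⟨y₁, hy₁, y₂, hy₂, rfl⟩ := (LieSubmodule.mem_sup _ _ _).mp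
        (hIJ.sup_eq_top ▸ LieSubmodule.mem_top y : y ∈ I ⊔ J)
      have h₁ : toEnd k s E y₁ = 0 := hy₁
      rw [map_add, show traceForm k s E x y₂ = 0 from hx ⟨y₂, hy₂⟩, add_zero,
        traceForm_apply_apply, h₁]
      simp
    rw [hK] at hxK
    exact Subtype.ext hxK
  · ext x : 1
    have : I = ⊤ := by simpa [hJ0] using hIJ.sup_eq_top
    have hx : x ∈ I := this ▸ LieSubmodule.mem_top x
    exact hx

variable (k s E) in
/-- A multiple of the Casimir operator. -/
theorem exists_casimir [CharZero k] [FiniteDimensional k s] [FiniteDimensional k E]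
    [HasTrivialRadical k s] (h : toEnd k s E ≠ 0) :
    ∃ C : Module.End k E, (∀ (x : s) (e : E), C ⁅x, e⁆ = ⁅x, C e⁆) ∧
      (∀ l : E →ₗ[k] k, (∀ (x : s) (e : E), l ⁅x, e⁆ = 0) → ∀ e, l (C e) = 0) ∧
      ¬ IsNilpotent C := by
  classical
  obtain ⟨J, hJ, hJ0⟩ := exists_ideal_traceForm_nondegenerate k s E
  set Φ : LinearMap.BilinForm k J := traceForm k J E
  have hsymm (x y : J) : Φ x y = Φ y x := traceForm_comm k J E x y
  let b := Module.finBasis k J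
  let b' := LinearMap.BilinForm.dualBasis Φ hJ b
  have hb'b (i j) : Φ (b' i) (b j) = if j = i then 1 else 0 :=
    LinearMap.BilinForm.apply_dualBasis_left hJ b i j
  have hexp' (y : J) : y = ∑ j, Φ y (b j) • b' j := by
    conv_lhs => rw [← b'.sum_repr y]
    simp [b']
  have hexp (y : J) : y = ∑ j, Φ y (b' j) • b j := by
    conv_lhs => rw [← b.sum_repr y]
    refine Finset.sum_congr rfl fun j _ ↦ ?_
    have : Φ y (b' j) = b.repr y j := by
      rw [hsymm]
      conv_lhs => rw [← b.sum_repr y]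
      simp only [map_sum, map_smul, hb'b, smul_eq_mul, mul_ite, mul_one, mul_zero]
      simp
    rw [this]
  let C : Module.End k E := ∑ i, toEnd k s E (b i) * toEnd k s E (b' i)
  have hC (e : E) : C e = ∑ i, ⁅(b i : s), ⁅(b' i : s), e⁆⁆ := by
    simp [C, LinearMap.sum_apply]
  refine ⟨C, fun x e ↦ ?_, fun l hl e ↦ ?_, fun hnil ↦ ?_⟩
  -- Invariance of the form makes the matrices of `ad x` in the dual bases negative transposes, so
  -- the terms of the commutator cancel in pairs.
  · let a (i j) : k := Φ ⁅x, b i⁆ (b' j)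
    have h₁ (i) : ⁅x, (b i : s)⁆ = ∑ j, a i j • (b j : s) := by
      simpa using congrArg (fun z : J ↦ (z : s)) (hexp ⁅x, b i⁆)
    have h₂ (i) : ⁅x, (b' i : s)⁆ = ∑ j, (-a j i) • (b' j : s) := by
      have := congrArg (fun z : J ↦ (z : s)) (hexp' ⁅x, b' i⁆)
      have h₃ (j) : Φ ⁅x, b' i⁆ (b j) = - a j i := by
        rw [show a j i = Φ (b' i) ⁅x, b j⁆ from hsymm _ _]
        exact traceForm_apply_lie_apply' k s E x (b' i : s) (b j)
      simpa [h₃] using this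
    rw [hC, hC, lie_sum, eq_comm, ← sub_eq_zero, ← Finset.sum_sub_distrib]
    have h₄ (i) : ⁅x, ⁅(b i : s), ⁅(b' i : s), e⁆⁆⁆ - ⁅(b i : s), ⁅(b' i : s), ⁅x, e⁆⁆⁆ =
        ∑ j, a i j • ⁅(b j : s), ⁅(b' i : s), e⁆⁆ - ∑ j, a j i • ⁅(b i : s), ⁅(b' j : s), e⁆⁆ := by
      rw [leibniz_lie x (b i : s), leibniz_lie x (b' i : s), h₁, h₂, sum_lie, sum_lie, lie_add,
        lie_sum]
      simp only [smul_lie, lie_smul, neg_smul, Finset.sum_neg_distrib, neg_lie, lie_neg]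
      abel
    simp_rw [h₄]
    rw [Finset.sum_sub_distrib, Finset.sum_comm, sub_self]
  · rw [hC, map_sum]
    simp [hl]
  -- The trace of `C` is `dim J`, which is nonzero in characteristic zero.
  · have htr := (LinearMap.isNilpotent_trace_of_isNilpotent hnil).eq_zero
    have h₅ (i) : LinearMap.trace k E (toEnd k s E (b i) * toEnd k s E (b' i)) = 1 := by
      have : Φ (b i) (b' i) = 1 := by rw [hsymm, hb'b, if_pos rfl]
      exact this
    simp only [C, map_sum, h₅, Finset.sum_const, Finset.card_univ, Fintype.card_fin,
      nsmul_eq_mul, mul_one, Nat.cast_eq_zero] at htr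
    have : Subsingleton J := Module.finrank_zero_iff.mp htr
    exact h (hJ0 ((LieSubmodule.eq_bot_iff J).mpr fun x hx ↦
      congrArg Subtype.val (Subsingleton.elim (⟨x, hx⟩ : J) 0)))

/-- The codimension-one case of **Weyl's theorem** on complete reducibility. -/
theorem exists_invariant_of_functional [CharZero k] [FiniteDimensional k s] [FiniteDimensional k E]
    [HasTrivialRadical k s] {l : E →ₗ[k] k} (hl : ∀ (x : s) (e : E), l ⁅x, e⁆ = 0) (hl0 : l ≠ 0) :
    ∃ e, l e = 1 ∧ ∀ x : s, ⁅x, e⁆ = 0 := by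
  induction hd : Module.finrank k E using Nat.strong_induction_on generalizing E with
  | h d ih =>
  obtain ⟨e₀, he₀⟩ : ∃ e, l e = 1 := by
    obtain ⟨y, hy⟩ := DFunLike.ne_iff.mp hl0
    exact ⟨(l y)⁻¹ • y, by simpa using inv_mul_cancel₀ hy⟩
  by_cases htriv : toEnd k s E = 0
  · exact ⟨e₀, he₀, fun x ↦ by rw [← toEnd_apply_apply k, htriv]; simp⟩
  obtain ⟨C, hcomm, hlC, hnil⟩ := exists_casimir k s E htriv
  -- Fitting decomposition for `C`. Since `n ≥ 1`, `l` vanishes on the range of `C ^ n`, so it is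
  -- nonzero on the kernel, which is proper as `C` is not nilpotent.
  obtain ⟨n, hn, hn1⟩ := ((LinearMap.eventually_isCompl_ker_pow_range_pow C).and
    (Filter.eventually_ge_atTop 1)).exists
  let F : LieSubmodule k s E :=
    { LinearMap.ker (C ^ n) with
      lie_mem := fun {x e} he ↦ by
        have h (j : ℕ) : (C ^ j) ⁅x, e⁆ = ⁅x, (C ^ j) e⁆ := by
          induction j with
          | zero => rfl
          | succ j ih => rw [pow_succ', Module.End.mul_apply, ih, hcomm]; rfl
        change (C ^ n) ⁅x, e⁆ = 0
        rw [h, show (C ^ n) e = 0 from he, lie_zero] }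
  have hF : Module.finrank k F < d := by
    rw [← hd]
    refine Submodule.finrank_lt (s := F.toSubmodule) fun htop ↦ hnil ⟨n, ?_⟩
    exact LinearMap.ker_eq_top.mp htop
  have hlF : l.comp F.toSubmodule.subtype ≠ 0 := by
    intro h0
    obtain ⟨u, hu, v, ⟨w, rfl⟩, huv⟩ := Submodule.mem_sup.mp
      (hn.sup_eq_top ▸ Submodule.mem_top : e₀ ∈ _ ⊔ _)
    have h₁ : l u = 0 := LinearMap.congr_fun h0 (⟨u, hu⟩ : F)
    have h₂ : l ((C ^ n) w) = 0 := by
      obtain ⟨m, rfl⟩ := Nat.exists_eq_add_of_le' hn1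
      rw [pow_succ', Module.End.mul_apply, hlC l hl]
    rw [← huv, map_add, h₁, h₂, add_zero] at he₀
    exact zero_ne_one he₀
  obtain ⟨e, he, hinv⟩ := ih _ hF (E := F) (l := l.comp F.toSubmodule.subtype)
    (fun x e ↦ hl x e) hlF rfl
  exact ⟨e, he, fun x ↦ congrArg Subtype.val (hinv x)⟩

end LieAlgebra

/-! ### Levi's theorem. -/

namespace LieAlgebra

open LieModule

variable {k g s : Type*} [Field k] [LieRing g] [LieAlgebra k g] [LieRing s] [LieAlgebra k s]

/-- The kernel of `π` acts trivially on `E ⧸ P`, which thus becomes an `s`-module to which the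
codimension-one case of Weyl's theorem applies. -/
theorem exists_invariant_mod_submodule [CharZero k] [FiniteDimensional k s]
    [HasTrivialRadical k s] {π : g →ₗ⁅k⁆ s} (hπ : Function.Surjective π) {E : Type*}
    [AddCommGroup E] [Module k E] [LieRingModule g E] [LieModule k g E] [FiniteDimensional k E]
    {P : LieSubmodule k g E} (hP : ∀ x ∈ π.ker, ∀ e : E, ⁅x, e⁆ ∈ P) {l : E →ₗ[k] k}
    (hl : ∀ (x : g) (e : E), l ⁅x, e⁆ = 0) (hlP : ∀ e ∈ P, l e = 0) (hl0 : l ≠ 0) :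
    ∃ e, l e = 1 ∧ ∀ x : g, ⁅x, e⁆ ∈ P := by
  obtain ⟨τ, hτ⟩ := (π : g →ₗ[k] s).exists_rightInverse_of_surjective
    (LinearMap.range_eq_top.mpr hπ)
  replace hτ (t : s) : π (τ t) = t := LinearMap.congr_fun hτ t
  have hker (x : g) (hx : π x = 0) : toEnd k g (E ⧸ P) x = 0 := by
    ext q
    obtain ⟨e, rfl⟩ := P.toSubmodule.mkQ_surjective q
    exact (Submodule.Quotient.mk_eq_zero _).mpr (hP x hx e)
  let ρ : s →ₗ⁅k⁆ Module.End k (E ⧸ P) :=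
    { (toEnd k g (E ⧸ P) : g →ₗ[k] Module.End k (E ⧸ P)).comp τ with
      map_lie' := fun {t u} ↦ by
        change toEnd k g (E ⧸ P) (τ ⁅t, u⁆) = ⁅toEnd k g (E ⧸ P) (τ t), toEnd k g (E ⧸ P) (τ u)⁆
        rw [← LieHom.map_lie, ← sub_eq_zero, ← map_sub]
        exact hker _ (by simp [hτ]) }
  have hρ (y : g) : ρ (π y) = toEnd k g (E ⧸ P) y := by
    change toEnd k g (E ⧸ P) (τ (π y)) = _
    rw [← sub_eq_zero, ← map_sub]
    exact hker _ (by simp [hτ])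
  let _ : LieRingModule s (E ⧸ P) := LieRingModule.compLieHom (E ⧸ P) ρ
  have : LieModule k s (E ⧸ P) := LieModule.compLieHom (E ⧸ P) ρ
  have hact (y : g) (e : E) : ⁅π y, P.toSubmodule.mkQ e⁆ = P.toSubmodule.mkQ ⁅y, e⁆ :=
    LinearMap.congr_fun (hρ y) _
  obtain ⟨q, hq, hinv⟩ := exists_invariant_of_functional (k := k) (s := s) (E := E ⧸ P)
    (l := P.toSubmodule.liftQ l hlP)
    (fun t q ↦ by
      obtain ⟨y, rfl⟩ := hπ t
      obtain ⟨e, rfl⟩ := P.toSubmodule.mkQ_surjective q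
      rw [hact]
      exact hl y e)
    (fun h ↦ hl0 (LinearMap.ext fun e ↦ LinearMap.congr_fun h (P.toSubmodule.mkQ e)))
  obtain ⟨e, rfl⟩ := P.toSubmodule.mkQ_surjective q
  exact ⟨e, hq, fun y ↦ (Submodule.Quotient.mk_eq_zero P.toSubmodule).mp
    ((hact y e).symm.trans (hinv (π y)))⟩

theorem exists_section_of_subalgebra (π : g →ₗ⁅k⁆ s) (T : LieSubalgebra k g)
    (hsurj : ∀ t, ∃ y ∈ T, π y = t) (hinj : ∀ y ∈ T, π y = 0 → y = 0) :
    ∃ σ : s →ₗ⁅k⁆ g, ∀ t, π (σ t) = t := by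
  let e : T ≃ₗ⁅k⁆ s := LieEquiv.ofBijective (π.comp T.incl)
    ⟨(injective_iff_map_eq_zero _).mpr fun y hy ↦ Subtype.ext (hinj y y.2 hy), fun t ↦ by
      obtain ⟨y, hy, rfl⟩ := hsurj t
      exact ⟨⟨y, hy⟩, rfl⟩⟩
  exact ⟨T.incl.comp e.symm.toLieHom, fun t ↦ e.apply_symm_apply t⟩

/-- **Levi's theorem** for an extension by a minimal abelian ideal. -/
theorem exists_section_of_minimal [CharZero k] [FiniteDimensional k g] [FiniteDimensional k s]
    [HasTrivialRadical k s] {π : g →ₗ⁅k⁆ s} (hπ : Function.Surjective π)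
    (hab : ∀ x ∈ π.ker, ∀ y ∈ π.ker, ⁅x, y⁆ = 0) (hmin : ∀ I ≤ π.ker, I = ⊥ ∨ I = π.ker)
    (hne : π.ker ≠ ⊥) : ∃ σ : s →ₗ⁅k⁆ g, ∀ t, π (σ t) = t := by
  set r := π.ker with hr
  obtain ⟨x₀, hx₀, hx₀0⟩ : ∃ x ∈ r, x ≠ 0 := by
    by_contra! h
    exact hne ((LieSubmodule.eq_bot_iff _).mpr h)
  obtain ⟨f, hf⟩ : ∃ f : g →ₗ[k] k, f x₀ = 1 := by
    obtain ⟨f, hf⟩ := not_forall.mp (mt (Module.forall_dual_apply_eq_zero_iff k x₀).mp hx₀0)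
    exact ⟨(f x₀)⁻¹ • f, by simpa using inv_mul_cancel₀ hf⟩
  -- Maps `g → r` that are scalar on `r`; the scalar is read off at `x₀` by `f`. Below, `P` consists
  -- of the maps `ad x` with `x ∈ r`.
  let E : LieSubmodule k g (g →ₗ[k] g) :=
    { carrier := {φ | (∀ y, φ y ∈ r) ∧ ∀ x ∈ r, φ x = f (φ x₀) • x}
      zero_mem' := ⟨fun y ↦ by simp, fun x _ ↦ by simp⟩
      add_mem' := fun {a b} ha hb ↦ ⟨fun y ↦ add_mem (ha.1 y) (hb.1 y), fun x hx ↦ by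
        rw [LinearMap.add_apply, ha.2 x hx, hb.2 x hx, LinearMap.add_apply, map_add, add_smul]⟩
      smul_mem' := fun c a ha ↦ ⟨fun y ↦ r.smul_mem c (ha.1 y), fun x hx ↦ by
        rw [LinearMap.smul_apply, ha.2 x hx, LinearMap.smul_apply, map_smul, smul_assoc]⟩
      lie_mem := fun {y φ} hφ ↦ by
        have h0 (x) (hx : x ∈ r) : ⁅y, φ⁆ x = 0 := by
          rw [LieHom.lie_apply, hφ.2 x hx, hφ.2 _ (r.lie_mem hx), lie_smul, sub_self]
        refine ⟨fun z ↦ ?_, fun x hx ↦ by rw [h0 x hx, h0 x₀ hx₀]; simp⟩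
        rw [LieHom.lie_apply]
        exact sub_mem (r.lie_mem (hφ.1 z)) (hφ.1 _) }
  let l : E →ₗ[k] k := f.comp ((LinearMap.applyₗ x₀).comp E.toSubmodule.subtype)
  have hE (φ : E) (x) (hx : x ∈ r) : (φ : g →ₗ[k] g) x = l φ • x := φ.2.2 x hx
  have hlie (y : g) (φ : E) (x) (hx : x ∈ r) : (⁅y, φ⁆ : E).1 x = 0 := by
    rw [LieSubmodule.coe_bracket, LieHom.lie_apply, hE φ x hx, hE φ _ (r.lie_mem hx), lie_smul,
      sub_self]
  let P : LieSubmodule k g E :=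
    { carrier := {φ | ∃ x ∈ r, (φ : g →ₗ[k] g) = ad k g x}
      zero_mem' := ⟨0, r.zero_mem, by simp⟩
      add_mem' := fun {a b} ⟨x, hx, hxa⟩ ⟨y, hy, hyb⟩ ↦ ⟨x + y, add_mem hx hy, by simp [hxa, hyb]⟩
      smul_mem' := fun c a ⟨x, hx, hxa⟩ ↦ ⟨c • x, r.smul_mem c hx, by simp [hxa]⟩
      lie_mem := fun {y a} ⟨x, hx, hxa⟩ ↦ ⟨⁅y, x⁆, r.lie_mem hx, by
        ext z
        rw [LieSubmodule.coe_bracket, LieHom.lie_apply, hxa]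
        simp⟩ }
  obtain ⟨p, hp⟩ := r.toSubmodule.subtype.exists_leftInverse_of_injective
    (Submodule.ker_subtype _)
  have hp' (x) (hx : x ∈ r) : (p x : g) = x :=
    congrArg Subtype.val (LinearMap.congr_fun hp (⟨x, hx⟩ : r))
  obtain ⟨φ, hφ1, hφ⟩ := exists_invariant_mod_submodule hπ (E := E) (P := P) (l := l)
    (fun x hx φ ↦ ⟨-l φ • x, r.smul_mem _ hx, by
      ext z
      rw [LieSubmodule.coe_bracket, LieHom.lie_apply, hab x hx _ (φ.2.1 z),
        hE φ _ (lie_mem_left k g r x z hx)]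
      simp⟩)
    (fun y φ ↦ by
      change f ((⁅y, φ⁆ : E).1 x₀) = 0
      rw [hlie y φ x₀ hx₀, map_zero])
    (fun φ ⟨x, hx, hxφ⟩ ↦ by
      change f (φ.1 x₀) = 0
      rw [hxφ, ad_apply, hab x hx x₀ hx₀, map_zero])
    (fun h ↦ by
      have := LinearMap.congr_fun h (⟨r.toSubmodule.subtype.comp p, fun y ↦ (p y).2, fun x hx ↦ by
        simp [hp' x hx, hp' x₀ hx₀, hf]⟩ : E)
      have h' : f (p x₀ : g) = 0 := this
      rw [hp' x₀ hx₀, hf] at h'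
      exact one_ne_zero h')
  -- So `φ` is a projection onto `r` whose failure to be equivariant is always some `ad x` with `x ∈
  -- r`.
  have hid (x) (hx : x ∈ r) : φ.1 x = x := by rw [hE φ x hx, hφ1, one_smul]
  have hπφ (y : g) : π (φ.1 y) = 0 := φ.2.1 y
  -- By minimality `r` meets the center trivially or is central. The complement is the stabilizer of
  -- `φ` in the first case; in the second `φ` is equivariant and the complement is its kernel.
  rcases hmin (r ⊓ center k g) inf_le_left with hz | hz
  · let T : LieSubalgebra k g :=
      { carrier := {y | ⁅y, φ⁆ = 0}
        zero_mem' := by simp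
        add_mem' := fun {a b} ha hb ↦ by
          rw [Set.mem_ofPred_eq, add_lie, show ⁅a, φ⁆ = 0 from ha, show ⁅b, φ⁆ = 0 from hb, add_zero]
        smul_mem' := fun c a ha ↦ by
          rw [Set.mem_ofPred_eq, smul_lie, show ⁅a, φ⁆ = 0 from ha, smul_zero]
        lie_mem' := fun {a b} ha hb ↦ by
          change ⁅⁅a, b⁆, φ⁆ = 0
          rw [lie_lie, show ⁅a, φ⁆ = 0 from ha, show ⁅b, φ⁆ = 0 from hb, lie_zero, lie_zero,
            sub_zero] }
    have hx (x) (hx : x ∈ r) : (⁅x, φ⁆ : E).1 = - ad k g x := by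
      ext z
      rw [LieSubmodule.coe_bracket, LieHom.lie_apply, hab x hx _ (φ.2.1 z),
        hid _ (lie_mem_left k g r x z hx)]
      simp
    refine exists_section_of_subalgebra π T (fun t ↦ ?_) fun y hy hπy ↦ ?_
    · obtain ⟨y, rfl⟩ := hπ t
      obtain ⟨x, hxr, hxy⟩ := hφ y
      refine ⟨y + x, Subtype.ext ?_, by rw [map_add, show π x = 0 from hxr, add_zero]⟩
      rw [add_lie]
      change (⁅y, φ⁆ : E).1 + (⁅x, φ⁆ : E).1 = 0
      rw [hxy, hx x hxr, add_neg_cancel]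
    · have h1 : ad k g y = 0 := by
        rw [← neg_eq_zero, ← hx y hπy, show ⁅y, φ⁆ = 0 from hy]
        rfl
      have : y ∈ r ⊓ center k g := by
        refine ⟨hπy, (mem_maxTrivSubmodule k g g y).mpr fun z ↦ ?_⟩
        rw [← lie_skew, ← ad_apply k, h1]
        simp
      rwa [hz] at this
  · have hcen (x) (hx : x ∈ r) : ad k g x = 0 := by
      have : x ∈ center k g := (hz.ge hx).2
      ext z
      rw [ad_apply, ← lie_skew, (mem_maxTrivSubmodule k g g x).mp this z]
      simp
    have hequi (y z : g) : φ.1 ⁅y, z⁆ = ⁅y, φ.1 z⁆ := by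
      obtain ⟨x, hxr, hxy⟩ := hφ y
      have := LinearMap.congr_fun hxy z
      rw [hcen x hxr, LieSubmodule.coe_bracket, LieHom.lie_apply] at this
      exact (sub_eq_zero.mp this).symm
    let T : LieSubalgebra k g :=
      { LinearMap.ker φ.1 with
        lie_mem' := fun {a b} _ hb ↦ by
          change φ.1 ⁅a, b⁆ = 0
          rw [hequi, show φ.1 b = 0 from hb, lie_zero] }
    refine exists_section_of_subalgebra π T (fun t ↦ ?_) fun y hy hπy ↦ ?_
    · obtain ⟨y, rfl⟩ := hπ t
      refine ⟨y - φ.1 y, ?_, by rw [map_sub, hπφ, sub_zero]⟩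
      change φ.1 (y - φ.1 y) = 0
      rw [map_sub, hid _ (φ.2.1 y), sub_self]
    · rw [← hid y hπy]
      exact hy

/-- The homomorphism from a quotient induced by a homomorphism vanishing on the ideal. -/
def quotientLift (I : LieIdeal k g) (π : g →ₗ⁅k⁆ s) (h : I ≤ π.ker) : g ⧸ I →ₗ⁅k⁆ s :=
  { I.toSubmodule.liftQ (π : g →ₗ[k] s) h with
    map_lie' := fun {x y} ↦ by
      obtain ⟨x, rfl⟩ := quotientHom_surjective I x
      obtain ⟨y, rfl⟩ := quotientHom_surjective I y
      rw [← LieHom.map_lie]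
      exact π.map_lie x y }

@[simp]
theorem quotientLift_quotientHom (I : LieIdeal k g) (π : g →ₗ⁅k⁆ s) (h : I ≤ π.ker) (x : g) :
    quotientLift I π h (quotientHom I x) = π x := rfl

/-- **Levi's theorem**: a surjection onto a semisimple Lie algebra with solvable kernel splits. -/
theorem exists_levi_section [CharZero k] [FiniteDimensional k g] [FiniteDimensional k s]
    [HasTrivialRadical k s] {π : g →ₗ⁅k⁆ s} (hπ : Function.Surjective π) [IsSolvable π.ker] :
    ∃ σ : s →ₗ⁅k⁆ g, ∀ t, π (σ t) = t := by
  induction hd : Module.finrank k g using Nat.strong_induction_on generalizing g with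
  | h d ih =>
  by_cases hbot : π.ker = ⊥
  · refine exists_section_of_subalgebra π ⊤ (fun t ↦ ?_) fun y _ hy ↦ ?_
    · obtain ⟨y, rfl⟩ := hπ t
      exact ⟨y, LieSubalgebra.mem_top y, rfl⟩
    · have : y ∈ π.ker := hy
      rwa [hbot] at this
  by_cases hmin : ∀ I ≤ π.ker, I = ⊥ ∨ I = π.ker
  · refine exists_section_of_minimal hπ ?_ hmin hbot
    have hder : ⁅π.ker, π.ker⁆ = ⊥ := by
      -- If `⁅r, r⁆ = r`, the derived series of `r` is constant, contradicting solvability.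
      refine (hmin _ (LieSubmodule.lie_le_left _ _)).resolve_right fun h ↦ hbot ?_
      obtain ⟨n, hn⟩ := IsSolvable.solvable k π.ker
      rw [LieIdeal.derivedSeries_eq_bot_iff] at hn
      rw [← hn]
      clear hn
      induction n with
      | zero => rfl
      | succ n ihn => rw [derivedSeriesOfIdeal_succ, ← ihn, h]
    intro x hx y hy
    have := LieSubmodule.lie_mem_lie hx hy
    rwa [hder] at this
  · push Not at hmin
    obtain ⟨I, hI, hI0, hI1⟩ := hmin
    have hsol : IsSolvable (quotientLift I π hI).ker := by
      refine Function.Surjective.lieAlgebra_isSolvable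
        (f := restrictHom (J := π.ker) (I := (quotientLift I π hI).ker) (quotientHom I)
          fun x hx ↦ hx) fun ⟨q, hq⟩ ↦ ?_
      obtain ⟨x, rfl⟩ := quotientHom_surjective I q
      exact ⟨⟨x, hq⟩, rfl⟩
    have hId : Module.finrank k (g ⧸ I) < d := by
      have h₁ := Submodule.finrank_quotient_add_finrank I.toSubmodule
      have h₂ : 0 < Module.finrank k I.toSubmodule :=
        Nat.pos_of_ne_zero (mt Submodule.finrank_eq_zero.mp (by simpa using hI0))
      change Module.finrank k (g ⧸ I.toSubmodule) < d
      omega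
    obtain ⟨σ₁, hσ₁⟩ := ih _ hId (π := quotientLift I π hI) (fun t ↦ by
        obtain ⟨y, rfl⟩ := hπ t
        exact ⟨quotientHom I y, rfl⟩) rfl
    -- The preimage in `g` of the Levi subalgebra of `g ⧸ I`; it meets `π.ker` in `I`, so it is
    -- proper.
    let T : LieSubalgebra k g :=
      { LinearMap.ker ((quotientHom I : g →ₗ[k] g ⧸ I) - (σ₁.comp π : g →ₗ[k] g ⧸ I)) with
        lie_mem' := fun {a b} ha hb ↦ by
          change quotientHom I ⁅a, b⁆ - σ₁ (π ⁅a, b⁆) = 0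
          rw [LieHom.map_lie, LieHom.map_lie, LieHom.map_lie,
            sub_eq_zero.mp (show quotientHom I a - σ₁ (π a) = 0 from ha),
            sub_eq_zero.mp (show quotientHom I b - σ₁ (π b) = 0 from hb), sub_self] }
    have hT {y : g} : y ∈ T ↔ quotientHom I y = σ₁ (π y) :=
      sub_eq_zero (a := quotientHom I y)
    have hTd : Module.finrank k T < d := by
      rw [← hd]
      refine Submodule.finrank_lt (s := T.toSubmodule) fun htop ↦ hI1 (le_antisymm hI fun x hx ↦ ?_)
      have hxT : x ∈ T := by
        change x ∈ T.toSubmodule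
        rw [htop]
        exact Submodule.mem_top
      rw [hT, show π x = 0 from hx, map_zero] at hxT
      exact (quotientHom_eq_zero_iff I).mp hxT
    have hTs : IsSolvable (π.comp T.incl).ker :=
      Function.Injective.lieAlgebra_isSolvable
        (f := restrictHom (J := (π.comp T.incl).ker) (I := π.ker) T.incl fun x hx ↦ hx)
        fun x y hxy ↦ Subtype.ext (Subtype.ext (congrArg (fun z : π.ker ↦ (z : g)) hxy))
    obtain ⟨σ, hσ⟩ := ih _ hTd (π := π.comp T.incl) (fun t ↦ by
      obtain ⟨y, hy⟩ := quotientHom_surjective I (σ₁ t)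
      have hyt : π y = t := by
        rw [← quotientLift_quotientHom I π hI, hy, hσ₁]
      exact ⟨⟨y, hT.mpr (by rw [hy, hyt])⟩, hyt⟩) rfl
    exact ⟨T.incl.comp σ, hσ⟩

end LieAlgebra

/-! ### The radical and Ado's theorem. -/

namespace LieAlgebra

open LieModule

variable {k g : Type*} [Field k] [LieRing g] [LieAlgebra k g]

/-- Elements of `⁅g, radical g⁆` act nilpotently on all finite-dimensional representations. -/
theorem isNilpotent_toEnd_of_mem_lie_radical [CharZero k] [IsAlgClosed k] [FiniteDimensional k g]
    {M : Type*} [AddCommGroup M] [Module k M] [LieRingModule g M] [LieModule k g M]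
    [FiniteDimensional k M] {a : g} (ha : a ∈ ⁅(⊤ : LieIdeal k g), radical k g⁆) :
    IsNilpotent (toEnd k g M a) := by
  induction hd : Module.finrank k M using Nat.strong_induction_on generalizing M with
  | h d ih =>
  rcases subsingleton_or_nontrivial M with hM | hM
  · exact ⟨1, Subsingleton.elim _ _⟩
  obtain ⟨χ, hχ⟩ := exists_nontrivial_weightSpace_of_isSolvable k (radical k g) M
  let W : LieSubmodule k g M := weightSpaceOfIsLieTower k M χ
  have hW (x : radical k g) (w : M) (hw : w ∈ W) : ⁅(x : g), w⁆ = χ x • w :=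
    (mem_weightSpace χ w).mp hw x
  have hWn : Nontrivial W := hχ
  have har : a ∈ radical k g := LieSubmodule.lie_le_right _ _ ha
  have haW : toEnd k g W a = χ ⟨a, har⟩ • 1 := by
    ext w
    exact hW ⟨a, har⟩ w w.2
  -- On the `g`-stable weight space `W`, `a` is a scalar and also a sum of commutators, so its trace
  -- vanishes and characteristic zero forces `χ a = 0`.
  have htr : LinearMap.trace k W (toEnd k g W a) = 0 := by
    have hle : (⁅(⊤ : LieIdeal k g), radical k g⁆ : LieIdeal k g).toSubmodule ≤
        LinearMap.ker ((LinearMap.trace k W).comp (toEnd k g W : g →ₗ[k] Module.End k W)) := by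
      rw [LieSubmodule.lieIdeal_oper_eq_linear_span', Submodule.span_le]
      rintro - ⟨y, -, x, -, rfl⟩
      simp [LieRing.of_associative_ring_bracket, LinearMap.trace_mul_comm k (toEnd k g W y)]
    exact hle ha
  have hχa : χ ⟨a, har⟩ = 0 := by
    rw [haW, map_smul, LinearMap.trace_one, smul_eq_mul] at htr
    exact (mul_eq_zero.mp htr).resolve_right (Nat.cast_ne_zero.mpr Module.finrank_pos.ne')
  have hq : Module.finrank k (M ⧸ W) < d := by
    have h₁ := Submodule.finrank_quotient_add_finrank W.toSubmodule
    have h₂ : 0 < Module.finrank k W.toSubmodule := Module.finrank_pos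
    change Module.finrank k (M ⧸ W.toSubmodule) < d
    omega
  obtain ⟨n, hn⟩ := ih _ hq (M := M ⧸ W) rfl
  refine ⟨n + 1, LinearMap.ext fun m ↦ ?_⟩
  have hpow (j : ℕ) : W.toSubmodule.mkQ ((toEnd k g M a ^ j) m) =
      (toEnd k g (M ⧸ W) a ^ j) (W.toSubmodule.mkQ m) := by
    induction j with
    | zero => rfl
    | succ j ihj => rw [pow_succ', pow_succ', Module.End.mul_apply, Module.End.mul_apply, ← ihj]; rfl
  have hmem : (toEnd k g M a ^ n) m ∈ W := by
    refine (Submodule.Quotient.mk_eq_zero W.toSubmodule).mp ((hpow n).trans ?_)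
    rw [hn]
    rfl
  rw [pow_succ', Module.End.mul_apply, toEnd_apply_apply, hW ⟨a, har⟩ _ hmem, hχa, zero_smul]
  rfl

/-- The preimage of a solvable ideal is an extension of solvable by solvable, hence lies in the
radical. -/
instance hasTrivialRadical_quotient_radical [FiniteDimensional k g] :
    HasTrivialRadical k (g ⧸ radical k g) := by
  refine hasTrivialRadical_of_no_solvable_ideals fun I hI ↦ ?_
  set J : LieIdeal k g := I.comap (quotientHom (radical k g)) with hJ
  obtain ⟨n, hn⟩ := IsSolvable.solvable k I
  obtain ⟨m, hm⟩ := IsSolvable.solvable k (radical k g)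
  rw [LieIdeal.derivedSeries_eq_bot_iff] at hm
  have hmap := LieIdeal.derivedSeries_map_le (R := k)
    (f := restrictHom (J := J) (I := I) (quotientHom (radical k g)) fun x hx ↦ by
      simpa [hJ] using hx) n
  have hle : derivedSeriesOfIdeal k g n J ≤ radical k g := by
    rw [← LieIdeal.derivedSeries_eq_derivedSeriesOfIdeal_map, LieIdeal.map_le]
    rintro - ⟨x, hx, rfl⟩
    have h := hmap (LieIdeal.mem_map hx)
    rw [hn] at h
    exact (quotientHom_eq_zero_iff _).mp (congrArg Subtype.val h)
  have hJsol : IsSolvable J := by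
    refine IsSolvable.mk (R := k) (k := m + n) ?_
    rw [LieIdeal.derivedSeries_eq_bot_iff, derivedSeriesOfIdeal_add, eq_bot_iff, ← hm]
    exact derivedSeriesOfIdeal_mono hle m
  have hJr : J ≤ radical k g := (LieIdeal.solvable_iff_le_radical k g J).mp hJsol
  rw [LieSubmodule.eq_bot_iff]
  intro q hq
  obtain ⟨x, rfl⟩ := quotientHom_surjective (radical k g) q
  exact (quotientHom_eq_zero_iff _).mpr (hJr (by simpa [hJ] using hq))

variable (k g) in
theorem exists_rep_faithful_on_center [CharZero k] [IsAlgClosed k] [FiniteDimensional k g] :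
    ∃ (n : ℕ) (ρ : g →ₗ⁅k⁆ Module.End k (Fin n → k)), ∀ x ∈ center k g, ρ x = 0 → x = 0 := by
  -- Adding the center to `⁅g, r⁆` keeps `N` nilpotent and gives the induction a set on which to
  -- stay faithful.
  set r := radical k g with hr
  set N : LieIdeal k g := ⁅(⊤ : LieIdeal k g), r⁆ ⊔ center k g with hN
  have hcN : center k g ≤ N := le_sup_right
  have hNr : N ≤ r := sup_le (LieSubmodule.lie_le_right _ _) (center_le_radical k g)
  have hlie (y x : g) (hx : x ∈ r) : ⁅y, x⁆ ∈ N :=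
    le_sup_left (a := ⁅(⊤ : LieIdeal k g), r⁆) (LieSubmodule.lie_mem_lie (LieSubmodule.mem_top y) hx)
  have hNnil : LieRing.IsNilpotent N := by
    rw [LieAlgebra.isNilpotent_iff_forall (R := k)]
    rintro ⟨x, hx⟩
    refine LieSubalgebra.isNilpotent_ad_of_isNilpotent_ad (N : LieSubalgebra k g) (x := ⟨x, hx⟩) ?_
    obtain ⟨a, ha, z, hz, rfl⟩ := (LieSubmodule.mem_sup _ _ _).mp hx
    have hz0 : ad k g z = 0 := by
      ext y
      rw [ad_apply, ← lie_skew, (mem_maxTrivSubmodule k g g z).mp hz y]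
      simp
    change IsNilpotent (ad k g (a + z))
    rw [map_add, hz0, add_zero]
    exact isNilpotent_toEnd_of_mem_lie_radical (M := g) ha
  have hcomm : IsLieAbelian ((center k g).comap N.incl) := ⟨fun x y ↦ by
    ext
    exact (mem_maxTrivSubmodule k g g _).mp
      (LieIdeal.mem_comap.mp y.2) _⟩
  have h₁ := hasNilRep_of_isNilpotent (k := k) ((center k g).comap N.incl)
  have h₂ : HasNilRep k (N.comap r.incl : Set r) {x : r | (x : g) ∈ center k g} := by
    refine HasNilRep.of_commutator_le (fun x hx ↦ ?_) (fun x y ↦ ?_)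
      (h₁.comap (f := restrictHom r.incl fun x hx ↦ ?_)
        (fun x y hxy ↦ Subtype.ext (Subtype.ext (congrArg (fun z : N ↦ (z : g)) hxy)))
        (fun _ _ ↦ Set.mem_univ _) fun x hx ↦ ?_)
    · simpa using hcN hx
    · simpa using hlie x y y.2
    · simpa using hx
    · exact hx
  have hker {x : g} : x ∈ (quotientHom r).ker ↔ x ∈ r := quotientHom_eq_zero_iff r
  have hsol : IsSolvable (quotientHom r).ker :=
    le_solvable_ideal_solvable (fun x hx ↦ hker.mp hx) (radicalIsSolvable k g)
  obtain ⟨σ, hσ⟩ := exists_levi_section (quotientHom_surjective r)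
  have h₃ : HasNilRep k {x : (quotientHom r).ker | (x : g) ∈ N}
      {x : (quotientHom r).ker | (x : g) ∈ (center k g : Set g)} :=
    h₂.comap (f := restrictHom LieHom.id fun x hx ↦ hker.mp hx)
      (fun x y hxy ↦ Subtype.ext (congrArg (fun z : r ↦ (z : g)) hxy))
      (fun x hx ↦ hx) fun x hx ↦ hx
  obtain ⟨n, ρ, -, hρ, -⟩ := h₃.exists_extension hσ (fun x hx ↦ hker.mpr (hNr hx))
    (fun x hx ↦ hker.mpr (hNr (hcN hx))) fun y x hx ↦ hlie y x (hker.mp hx)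
  exact ⟨n, ρ, hρ⟩

variable (k g) in
/-- **Ado's theorem** over an algebraically closed field of characteristic zero. -/
theorem exists_faithful_rep [CharZero k] [IsAlgClosed k] [FiniteDimensional k g] :
    ∃ (n : ℕ) (ρ : g →ₗ⁅k⁆ Module.End k (Fin n → k)), Function.Injective ρ := by
  obtain ⟨n, ρ, hρ⟩ := exists_rep_faithful_on_center k g
  let ρ₁ : g →ₗ⁅k⁆ Module.End k ((Fin n → k) × g) :=
    { toFun := fun x ↦ (ρ x).prodMap (ad k g x)
      map_add' := fun x y ↦ by ext <;> simp
      map_smul' := fun c x ↦ by ext <;> simp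
      map_lie' := fun {x y} ↦ by ext <;> simp [LieRing.of_associative_ring_bracket] }
  obtain ⟨m, ρ₂, -, h₂⟩ := exists_conj_rep ρ₁
  refine ⟨m, ρ₂, (injective_iff_map_eq_zero ρ₂).mpr fun x hx ↦ ?_⟩
  have h := h₂ x hx
  have h₃ : ρ x = 0 := LinearMap.ext fun v ↦
    congrArg Prod.fst (LinearMap.congr_fun h (v, 0))
  refine hρ x ((mem_maxTrivSubmodule k g g x).mpr fun y ↦ ?_) h₃
  have h₄ : ⁅x, y⁆ = 0 := congrArg Prod.snd (LinearMap.congr_fun h (0, y))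
  rw [← lie_skew, h₄, neg_zero]

end LieAlgebra

theorem mainTheorem1 (L : Type*) [LieRing L] [LieAlgebra ℂ L] [FiniteDimensional ℂ L] :
    ∃ (V : Type) (_ : AddCommGroup V) (_ : Module ℂ V) (_ : LieRingModule L V)
      (_ : LieModule ℂ L V), FiniteDimensional ℂ V ∧ LieModule.IsFaithful ℂ L V := by
  obtain ⟨n, ρ, hρ⟩ := LieAlgebra.exists_faithful_rep ℂ L
  let _ : LieRingModule L (Fin n → ℂ) := LieRingModule.compLieHom (Fin n → ℂ) ρ
  have : LieModule ℂ L (Fin n → ℂ) := LieModule.compLieHom (Fin n → ℂ) ρ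
  exact ⟨Fin n → ℂ, inferInstance, inferInstance, inferInstance, inferInstance, inferInstance, ⟨hρ⟩⟩
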